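/- Let $D$ be a non-commutative division ring with center $F$. Suppose that $D$ is strongly algebraic over $F$, that is: every element of $D$ is algebraic over $F$, and $D$ contains a maximal subfield $K$ (a commutative division subring that is maximal among the commutative division subrings of $D$) and a subset $S\subseteq K$ such that $K=F(S)$, the division subring generated by $F\cup S$, and for each $x\in D$ there are at most finitely many $y\in S$ with $xy\neq yx$. Let $n\geq 1$, and let $N$ be a subgroup of $GL_n(D)$ containing $F^*I=\{\alpha I : \alpha\in F^*\}$, where $I$ is the identity matrix. Then $N$ is not finitely generated. -/

import Mathlib

/-- A maximal subfield of a division ring `D`: a commutative division subring which is maximal,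
for inclusion, among all commutative division subrings of `D`. (Mathlib's `Subfield D`, for a
division ring `D`, is the type of division subrings of `D`, commutative or not.) -/
def IsMaximalSubfield {D : Type*} [DivisionRing D] (K : Subfield D) : Prop :=
  Maximal (fun L : Subfield D => ∀ x ∈ L, ∀ y ∈ L, x * y = y * x) K

/-- `D` is strongly algebraic over its center `F`: every element of `D` is algebraic over `F`, and
`D` has a maximal subfield `K` together with a subset `S` of `K` such that `K = F(S)` (the division
subring generated by `F` and `S`) and each `x` in `D` commutes with all but finitely many elements
of `S`. -/
def IsStronglyAlgebraic (D : Type*) [DivisionRing D] : Prop :=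
  Algebra.IsAlgebraic (Subring.center D) D ∧
    ∃ K : Subfield D, IsMaximalSubfield K ∧
      ∃ S : Set D, S ⊆ (K : Set D) ∧
        K = Subfield.closure ((Subring.center D : Set D) ∪ S) ∧
        ∀ x : D, {y ∈ S | x * y ≠ y * x}.Finite

/-- The subgroup `F* I = {α I | α ∈ F*}` of `GL_n(D)`, where `F` is the center of `D`. -/
def centralScalars (D : Type*) [DivisionRing D] (n : ℕ) :
    Subgroup (Matrix.GeneralLinearGroup (Fin n) D) :=
  ((Units.map (Matrix.scalar (Fin n) : D →+* Matrix (Fin n) (Fin n) D).toMonoidHom).comp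
    (Units.map (Subring.center D).subtype.toMonoidHom)).range

/-! If `N` were finitely generated, its entries, hence the center `F`, would lie in a subring
generated by a finite set `X`. Dropping from `S` the finitely many elements not commuting with `X`
leaves a subfield `L ⊆ K` with `K/L` finite and `X` in the centralizer `C` of `L`. As `K` is its own
centralizer, `C` is finite over `L`, so the subring embeds in matrices over a finitely generated
subring of `L`. That ring contains `F`, so `F` is finite by Zariski's lemma over `ℤ`. Then finitely
generated subrings of `D` are finite, and Wedderburn's theorem makes `D` commutative. -/

theorem Field.finite_of_module_finite_int (F : Type*) [Field F] [Module.Finite ℤ F] : Finite F := by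
  obtain ⟨p, hp⟩ := CharP.exists F
  rcases eq_or_ne p 0 with rfl | hp0
  · have := CharP.charP_to_charZero F
    have : Algebra.IsIntegral ℤ F := inferInstance
    exact absurd (isField_of_isIntegral_of_isField (R := ℤ) (S := F)
      (FaithfulSMul.algebraMap_injective ℤ F) (Field.toIsField F)) Int.not_isField
  · refine Module.finite_of_fg_torsion F ?_
    intro x
    refine ⟨⟨(p : ℤ), mem_nonZeroDivisors_of_ne_zero (by exact_mod_cast hp0)⟩, ?_⟩
    change (p : ℤ) • x = 0
    simp

section
variable {L K C : Type*} [Field L] [Field K] [DivisionRing C] [Algebra L K] [Algebra L C]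

/-- If the commutant of `K` in `C` is `K`, then `K`-linearly independent families in `C` give
`C`-linearly independent families of functions on `K`. -/
theorem eq_zero_of_sum_mul_eq_zero_of_commutant_le (f : K →+* C)
    (h : ∀ x : C, (∀ k, x * f k = f k * x) → x ∈ f.range) {ι : Type*} (c : ι → C)
    (hc : ∀ (s : Finset ι) (g : ι → K), ∑ i ∈ s, f (g i) * c i = 0 → ∀ i ∈ s, g i = 0)
    (s : Finset ι) : ∀ e : ι → C, (∀ k, ∑ i ∈ s, e i * (f k * c i) = 0) → ∀ i ∈ s, e i = 0 := by
  classical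
  induction s using Finset.induction_on with
  | empty => simp
  | insert a s ha ih =>
    intro e he
    by_cases hea : e a = 0
    · have := ih e (fun k => by simpa [Finset.sum_insert ha, hea] using he k)
      simpa [hea] using this
    -- Artin's trick: normalize the coefficient at `a` to 1; commutators with `f k'` then give a
    -- relation on `s` alone. By induction all coefficients commute with `f`, so come from `K`,
    -- against `hc`.
    · exfalso
      set e' : ι → C := fun i => (e a)⁻¹ * e i with he'
      have h1 : e' a = 1 := inv_mul_cancel₀ hea
      have h2 : ∀ k, ∑ i ∈ insert a s, e' i * (f k * c i) = 0 := fun k => by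
        simp only [he', mul_assoc]
        rw [← Finset.mul_sum, he k, mul_zero]
      have h3 : ∀ k', ∀ i ∈ s, f k' * e' i - e' i * f k' = 0 := by
        intro k'
        refine ih _ (fun k => ?_)
        have h4 : ∑ i ∈ insert a s, (f k' * e' i - e' i * f k') * (f k * c i) = 0 := by
          have h5 := h2 (k' * k)
          simp only [sub_mul, Finset.sum_sub_distrib]
          have h6 : ∑ i ∈ insert a s, f k' * e' i * (f k * c i) = 0 := by
            simp only [mul_assoc]
            rw [← Finset.mul_sum]
            rw [h2 k, mul_zero]
          rw [h6, zero_sub, neg_eq_zero, ← h5]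
          refine Finset.sum_congr rfl fun i _ => ?_
          simp [mul_assoc]
        rwa [Finset.sum_insert ha, h1, mul_one, one_mul, sub_self, zero_mul, zero_add] at h4
      have h4 : ∀ i ∈ insert a s, ∃ g : K, f g = e' i := by
        intro i hi
        refine RingHom.mem_range.1 (h _ fun k => ?_)
        rcases Finset.mem_insert.1 hi with rfl | hi
        · simp [h1]
        · exact (sub_eq_zero.1 (h3 k i hi)).symm
      choose! g hg using h4
      have h5 := hc (insert a s) g (by
        rw [← h2 1]
        exact Finset.sum_congr rfl fun i hi => by rw [hg i hi, map_one, one_mul]) a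
          (Finset.mem_insert_self _ _)
      have := hg a (Finset.mem_insert_self _ _)
      rw [h5, map_zero, h1] at this
      exact zero_ne_one this

/-- A `K`-basis `c` of `C` yields maps `k ↦ f k * c i`, independent over `C` in `K →ₗ[L] C`, whose
rank over `C` is only `[K : L]`. -/
theorem finiteDimensional_of_commutant_le [FiniteDimensional L K] (f : K →ₐ[L] C)
    (h : ∀ x : C, (∀ k, x * f k = f k * x) → ∃ k, f k = x) : FiniteDimensional L C := by
  let _ : Module K C := Module.compHom C (f : K →+* C)
  have hsmul : ∀ (k : K) (x : C), k • x = f k * x := fun _ _ => rfl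
  have : IsScalarTower L K C := ⟨fun l k x => by simp [hsmul]⟩
  let c := Module.Basis.ofVectorSpace K C
  let b := Module.finBasis L K
  have hfin : Module.Finite C (K →ₗ[L] C) := Module.Finite.equiv (b.constr C)
  let v : Module.Basis.ofVectorSpaceIndex K C → (K →ₗ[L] C) :=
    fun i => (LinearMap.mulRight L (c i)).comp f.toLinearMap
  have hv : LinearIndependent C v := by
    rw [linearIndependent_iff']
    intro s e he
    refine eq_zero_of_sum_mul_eq_zero_of_commutant_le (f : K →+* C)
      (fun x hx => RingHom.mem_range.2 (h x hx)) c ?_ s e (fun k => ?_)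
    · exact linearIndependent_iff'.1 c.linearIndependent
    · simpa [v] using LinearMap.congr_fun he k
  have := hv.finite
  have : Module.Finite K C := Module.Finite.of_basis c
  exact Module.Finite.trans K C
end

/-- The division subring of the elements of `D` commuting with every element of `s`. -/
def Subfield.commutant {D : Type*} [DivisionRing D] (s : Set D) : Subfield D :=
  { Subring.centralizer s with
    inv_mem' := fun _ hx => Set.inv_mem_centralizer₀ hx }

theorem Subfield.closure_commute {D : Type*} [DivisionRing D] {s : Set D}
    (h : ∀ x ∈ s, ∀ y ∈ s, x * y = y * x) :
    ∀ x ∈ Subfield.closure s, ∀ y ∈ Subfield.closure s, x * y = y * x := by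
  have h1 : Subfield.closure s ≤ Subfield.commutant s :=
    Subfield.closure_le.2 fun x hx y hy => h y hy x hx
  have h2 : Subfield.closure s ≤ Subfield.commutant (Subfield.closure s) :=
    Subfield.closure_le.2 fun x hx y hy => (h1 hy x hx).symm
  exact fun x hx y hy => h2 hy x hx

universe u

theorem IsMaximalSubfield.mem_of_commute {D : Type*} [DivisionRing D] {K : Subfield D}
    (hK : IsMaximalSubfield K) {x : D} (hx : ∀ y ∈ K, x * y = y * x) : x ∈ K := by
  have hc : ∀ a ∈ insert x (K : Set D), ∀ b ∈ insert x (K : Set D), a * b = b * a := by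
    rintro a (rfl | ha) b (rfl | hb)
    · rfl
    · exact hx b hb
    · exact (hx a ha).symm
    · exact hK.1 a ha b hb
  have hle : K ≤ Subfield.closure (insert x (K : Set D)) :=
    fun y hy => Subfield.subset_closure (Set.mem_insert_of_mem _ hy)
  exact hK.2 (Subfield.closure_commute hc) hle
    (Subfield.subset_closure (Set.mem_insert _ _))

/-- Every finite subset of a strongly algebraic division ring lies in a division subring which
contains the center and is finite-dimensional over an algebraic extension of the center. -/
theorem IsStronglyAlgebraic.exists_finiteDimensional {D : Type u} [DivisionRing D]
    (hD : IsStronglyAlgebraic D) {X : Set D} (hX : X.Finite) :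
    ∃ (C : Subfield D) (L : Type u) (_ : Field L) (_ : Algebra L C)
      (_ : Algebra (Subring.center D) L),
      Algebra.IsAlgebraic (Subring.center D) L ∧ FiniteDimensional L C ∧ X ⊆ C ∧
      ∀ z : Subring.center D, ((algebraMap L C (algebraMap (Subring.center D) L z) : C) : D) = z := by
  obtain ⟨halg, K, hK, S, hSK, hKS, hS⟩ := hD
  set F := Subring.center D with hF
  let S₀ : Set D := ⋃ x ∈ X, {y ∈ S | x * y ≠ y * x}
  have hS₀ : S₀.Finite := hX.biUnion fun x _ => hS x
  let L : Subfield D := Subfield.closure ((F : Set D) ∪ (S \ S₀))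
  have hLK : L ≤ K := by
    rw [hKS]
    exact Subfield.closure_mono (Set.union_subset_union_right _ Set.sdiff_subset)
  have hFL : F ≤ L.toSubring := fun z hz => Subfield.subset_closure (Or.inl hz)
  have hFK : F ≤ K.toSubring := fun z hz => hLK (hFL hz)
  let C : Subfield D := Subfield.commutant (L : Set D)
  have hKC : K ≤ C := fun k hk l hl => hK.1 l (hLK hl) k hk
  have hLC : L ≤ C := hLK.trans hKC
  have hXC : X ⊆ C := by
    intro x hx
    have : L ≤ Subfield.commutant {x} := by
      refine Subfield.closure_le.2 ?_
      rintro y (hy | ⟨hyS, hy⟩) _ rfl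
      · exact Subring.mem_center_iff.1 hy _
      · by_contra hne
        exact hy (Set.mem_biUnion hx ⟨hyS, hne⟩)
    exact fun l hl => (this hl x rfl).symm
  let _ : Field L :=
    { (inferInstance : DivisionRing L) with
      mul_comm := fun a b => Subtype.ext (hK.1 a (hLK a.2) b (hLK b.2)) }
  let _ : Field K :=
    { (inferInstance : DivisionRing K) with
      mul_comm := fun a b => Subtype.ext (hK.1 a a.2 b b.2) }
  let _ : Algebra L C := RingHom.toAlgebra' (Subring.inclusion (S := L.toSubring)
    (T := C.toSubring) hLC) fun l c => Subtype.ext (c.2 l l.2)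
  let _ : Algebra L K := RingHom.toAlgebra (Subring.inclusion (S := L.toSubring)
    (T := K.toSubring) hLK)
  let _ : Algebra F L := RingHom.toAlgebra (Subring.inclusion (S := F)
    (T := L.toSubring) hFL)
  let _ : Algebra F K := RingHom.toAlgebra (Subring.inclusion (S := F)
    (T := K.toSubring) hFK)
  have : IsScalarTower F L K := IsScalarTower.of_algebraMap_eq fun _ => rfl
  let iL : L →ₐ[F] D := { L.subtype with commutes' := fun _ => rfl }
  let iK : K →ₐ[F] D := { K.subtype with commutes' := fun _ => rfl }
  have hFLalg : Algebra.IsAlgebraic F L :=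
    Algebra.IsAlgebraic.of_injective iL Subtype.val_injective
  have hFKalg : Algebra.IsAlgebraic F K :=
    Algebra.IsAlgebraic.of_injective iK Subtype.val_injective
  have hLKalg : Algebra.IsAlgebraic L K := Algebra.IsAlgebraic.tower_top (K := F) L
  -- `K` is algebraic over `L` and generated over it by the finite set `S₀` of discarded generators
  -- lying in `K`.
  have hLKfin : FiniteDimensional L K := by
    let T : Set K := {k | (k : D) ∈ S₀}
    have hT : T.Finite := hS₀.preimage Subtype.val_injective.injOn
    have : Finite T := hT
    have : FiniteDimensional L (IntermediateField.adjoin L T) :=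
      IntermediateField.finiteDimensional_adjoin
        fun x _ => (Algebra.IsAlgebraic.isAlgebraic x).isIntegral
    have htop : IntermediateField.adjoin L T = ⊤ := by
      rw [eq_top_iff]
      rintro k -
      let M : Subfield D := (IntermediateField.adjoin L T).toSubfield.map K.subtype
      have hKM : K ≤ M := by
        rw [hKS]
        refine Subfield.closure_le.2 ?_
        have hLM : ∀ l ∈ L, l ∈ M := fun l hl =>
          ⟨⟨l, hLK hl⟩, (IntermediateField.adjoin L T).algebraMap_mem ⟨l, hl⟩, rfl⟩
        rintro y (hy | hy)
        · exact hLM y (hFL hy)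
        · by_cases hy0 : y ∈ S₀
          · exact ⟨⟨y, hSK hy⟩, IntermediateField.subset_adjoin L T hy0, rfl⟩
          · exact hLM y (Subfield.subset_closure (Or.inr ⟨hy, hy0⟩))
      obtain ⟨k', hk', h⟩ := hKM k.2
      rwa [Subtype.ext h] at hk'
    rw [htop] at this
    exact Module.Finite.equiv (IntermediateField.topEquiv (F := L) (E := K)).toLinearEquiv
  let f : K →ₐ[L] C :=
    { Subring.inclusion (S := K.toSubring) (T := C.toSubring) hKC with
      commutes' := fun _ => rfl }
  refine ⟨C, L, inferInstance, inferInstance, inferInstance, hFLalg, ?_, hXC, fun _ => rfl⟩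
  refine finiteDimensional_of_commutant_le f fun x hx => ?_
  refine ⟨⟨x, hK.mem_of_commute fun y hy => ?_⟩, rfl⟩
  exact congrArg Subtype.val (hx ⟨y, hy⟩)

instance Int.isJacobsonRing : IsJacobsonRing ℤ := by
  rw [isJacobsonRing_iff_prime_eq]
  intro P hP
  rcases eq_or_ne P ⊥ with rfl | h
  · rw [eq_bot_iff]
    intro x hx
    -- The unit obtained is `3x² + 1`; being positive, it is 1, so `x = 0`.
    have hu := Ideal.mem_jacobson_bot.1 hx (3 * x)
    rw [Int.isUnit_iff] at hu
    rw [Ideal.mem_bot]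
    rcases hu with hu | hu <;> nlinarith [sq_nonneg x]
  · have := hP.isMaximal h
    exact Ideal.jacobson_eq_self_of_isMaximal

theorem Subring.algebra_finiteType_int_closure {R : Type*} [CommRing R] {E : Set R}
    (hE : E.Finite) : Algebra.FiniteType ℤ (Subring.closure E) := by
  have h : Algebra.FiniteType ℤ (Algebra.adjoin ℤ E) :=
    (Subalgebra.fg_iff_finiteType _).1 (Subalgebra.fg_def.2 ⟨E, hE, rfl⟩)
  have heq : (Algebra.adjoin ℤ E).toSubring = Subring.closure E := by
    rw [Algebra.adjoin_int]
    rfl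
  rw [← heq]
  exact h

theorem Subring.finite_closure_of_isAlgebraic {F L : Type*} [Field F] [Finite F] [Field L]
    [Algebra F L] [Algebra.IsAlgebraic F L] {E : Set L} (hE : E.Finite) :
    (Subring.closure E : Set L).Finite := by
  have : Finite E := hE
  have : FiniteDimensional F (IntermediateField.adjoin F E) :=
    IntermediateField.finiteDimensional_adjoin
      fun x _ => (Algebra.IsAlgebraic.isAlgebraic x).isIntegral
  have hfin : Finite (IntermediateField.adjoin F E) := Module.finite_of_finite F
  have hle : Subring.closure E ≤ (IntermediateField.adjoin F E).toSubalgebra.toSubring :=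
    Subring.closure_le.2 (IntermediateField.subset_adjoin F E)
  exact Set.Finite.subset (s := (IntermediateField.adjoin F E : Set L)) hfin hle

/-- A finitely generated subring of a strongly algebraic division ring contains the center only if
the center is finite, and it is finite if the center is. -/
theorem IsStronglyAlgebraic.closure_finite {D : Type u} [DivisionRing D]
    (hD : IsStronglyAlgebraic D) {X : Set D} (hX : X.Finite) :
    (Subring.center D ≤ Subring.closure X → Finite (Subring.center D)) ∧
      (Finite (Subring.center D) → (Subring.closure X : Set D).Finite) := by
  obtain ⟨C, L, _, _, _, halg, hfin, hXC, hz⟩ := hD.exists_finiteDimensional hX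
  let b := Module.finBasis L C
  let φ := Algebra.leftMulMatrix b
  have hφ : Function.Injective φ := Algebra.leftMulMatrix_injective b
  let Y : Set C := {x | (x : D) ∈ X}
  have hY : Y.Finite := hX.preimage Subtype.val_injective.injOn
  let E : Set L := ⋃ x ∈ Y, Set.range fun p : Fin _ × Fin _ => φ x p.1 p.2
  have hE : E.Finite := hY.biUnion fun x _ => Set.finite_range _
  let R : Subring L := Subring.closure E
  let A : Subring C := R.matrix.comap φ.toRingHom
  have hA : ∀ x ∈ Subring.closure X, ∃ y ∈ A, (y : D) = x := by
    have hle : Subring.closure X ≤ A.map C.subtype := by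
      refine Subring.closure_le.2 fun x hx => ⟨⟨x, hXC hx⟩, fun i j => ?_, rfl⟩
      exact Subring.subset_closure
        (Set.mem_biUnion (show (⟨x, hXC hx⟩ : C) ∈ Y from hx) ⟨(i, j), rfl⟩)
    exact fun x hx => hle hx
  constructor
  · intro hF
    have hFR : ∀ z : Subring.center D, algebraMap (Subring.center D) L z ∈ R := by
      intro z
      obtain ⟨y, hy, hyz⟩ := hA z (hF z.2)
      have hy' : y = algebraMap L C (algebraMap (Subring.center D) L z) :=
        Subtype.ext (hyz.trans (hz z).symm)
      -- A central `z` acts as a scalar matrix, so any diagonal entry recovers it; one exists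
      -- because `C ≠ 0`.
      let i : Fin (Module.finrank L C) := ⟨0, Module.finrank_pos⟩
      have := hy i i
      rw [hy'] at this
      change φ (algebraMap L C _) i i ∈ R at this
      rw [AlgHom.commutes] at this
      simpa [Matrix.algebraMap_matrix_apply] using this
    have := Subring.algebra_finiteType_int_closure hE
    let g : Subring.center D →+* R := (algebraMap (Subring.center D) L).codRestrict R hFR
    -- Zariski's lemma over the Jacobson ring `ℤ`: a field mapping to a nonzero `ℤ`-algebra of
    -- finite type is a finite `ℤ`-module.
    have : Module.Finite ℤ (Subring.center D) :=
      finite_of_algHom_finiteType_of_isJacobsonRing (K := ℤ) (A := R) g.toIntAlgHom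
    exact Field.finite_of_module_finite_int _
  · intro hF
    have hR : (R : Set L).Finite :=
      Subring.finite_closure_of_isAlgebraic (F := Subring.center D) hE
    have hM : (Set.univ.pi fun _ => Set.univ.pi fun _ => (R : Set L) :
        Set (Fin (Module.finrank L C) → Fin (Module.finrank L C) → L)).Finite :=
      Set.Finite.pi fun _ => Set.Finite.pi fun _ => hR
    have hAfin : (A : Set C).Finite := by
      refine Set.Finite.subset (hM.preimage (f := fun x => φ x) hφ.injOn) fun x hx i _ j _ => ?_
      exact hx i j
    refine (hAfin.image Subtype.val).subset fun x hx => ?_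
    obtain ⟨y, hy, rfl⟩ := hA x hx
    exact ⟨y, hy, rfl⟩

/-- Two elements generate a finite domain, commutative by Wedderburn's little theorem. -/
theorem IsStronglyAlgebraic.commute_of_finite_center {D : Type u} [DivisionRing D]
    (hD : IsStronglyAlgebraic D) (hF : Finite (Subring.center D)) (x y : D) : x * y = y * x := by
  have hfin : Finite (Subring.closure {x, y}) :=
    (hD.closure_finite (X := {x, y}) (by simp)).2 hF
  have h := (Finite.isDomain_to_isField (Subring.closure {x, y})).mul_comm
    ⟨x, Subring.subset_closure (by simp)⟩ ⟨y, Subring.subset_closure (by simp)⟩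
  exact congrArg Subtype.val h

/-- The entries of a finitely generated group of invertible matrices over a ring lie in a finitely
generated subring. -/
theorem Subgroup.FG.exists_entries_mem_closure {ι D : Type*} [Fintype ι] [DecidableEq ι] [Ring D]
    {N : Subgroup (Matrix.GeneralLinearGroup ι D)} (hN : N.FG) :
    ∃ X : Set D, X.Finite ∧ ∀ g ∈ N, ∀ i j, (g : Matrix ι ι D) i j ∈ Subring.closure X := by
  obtain ⟨T, rfl⟩ := hN
  let X : Set D := ⋃ g ∈ T, Set.range (fun p : ι × ι => (g : Matrix ι ι D) p.1 p.2) ∪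
    Set.range (fun p : ι × ι => ((g⁻¹ : Matrix.GeneralLinearGroup ι D) : Matrix ι ι D) p.1 p.2)
  refine ⟨X, T.finite_toSet.biUnion fun g _ => (Set.finite_range _).union (Set.finite_range _),
    fun g hg => ?_⟩
  change (g : Matrix ι ι D) ∈ (Subring.closure X).matrix
  induction hg using Subgroup.closure_induction'' with
  | mem g hg =>
    exact fun i j => Subring.subset_closure (Set.mem_biUnion hg (Or.inl ⟨(i, j), rfl⟩))
  | inv_mem g hg =>
    exact fun i j => Subring.subset_closure (Set.mem_biUnion hg (Or.inr ⟨(i, j), rfl⟩))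
  | one => exact one_mem _
  | mul g h _ _ hg hh => exact mul_mem hg hh

theorem theorem4p7 (D : Type*) [DivisionRing D] (hnc : ¬ ∀ x y : D, x * y = y * x)
    (hD : IsStronglyAlgebraic D) (n : ℕ) (hn : 1 ≤ n)
    (N : Subgroup (Matrix.GeneralLinearGroup (Fin n) D)) (hN : centralScalars D n ≤ N) :
    ¬ N.FG := by
  intro hfg
  obtain ⟨X, hX, hNX⟩ := hfg.exists_entries_mem_closure
  refine hnc (hD.commute_of_finite_center ((hD.closure_finite hX).1 fun z hz => ?_))
  by_cases hz0 : z = 0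
  · rw [hz0]
    exact zero_mem _
  · let u : (Subring.center D)ˣ :=
      Units.mk0 ⟨z, hz⟩ fun h => hz0 (congrArg Subtype.val h)
    -- The corner entry of `zI`, which exists as `n ≥ 1`, is `z` itself.
    have h := hNX _ (hN ⟨u, rfl⟩) ⟨0, hn⟩ ⟨0, hn⟩
    simpa [u] using h
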